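/- Let $\mu$ be a (positive) Borel measure on $\mathbb{R}$ with compact support $\Gamma$ which admits a density $\rho\ge 0$ with respect to Lebesgue measure that is Hölder continuous on $\mathbb{R}$. Let $G_\mu(z)=\int_\Gamma \frac{1}{z-x}\,d\mu(x)$, $z\in\mathbb{C}\setminus\Gamma$, be its Stieltjes transform. Put $a=\min\Gamma$, $b=\max\Gamma$ (arbitrary if $\mu=0$), $J(z)=\frac12\left(z+\frac1z\right)$ and $M_{(a,b)}(z)=\frac{b+a}{2}+\frac{b-a}{2}z$, and for $t\in[0,2\pi]$ let $$\gamma_r(t)=G_\mu\big(M_{(a,b)}(J(re^{\mathrm{i}t}))\big)\quad(0<r<1),\qquad \gamma_1(t)=\lim_{r\uparrow 1}\gamma_r(t)$$ (this limit exists for every $t$). For $A\subset\mathbb{R}$ let $C(A)\in\mathbb{N}\cup\{\infty\}$ be the number of connected components of $A$, that is, the number of equivalence classes of $A$ under the relation "the closed interval between the two points is contained in $A$". Let $\zeta\in\mathbb{C}\setminus\mathbb{R}$ be a point that does not lie on the image $\gamma_1([0,2\pi])$. Then the number of solutions $z\in\mathbb{C}\setminus\Gamma$ of $G_\mu(z)=\zeta$,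 counted with multiplicity, is at most $$\frac12\, C\left(\left\{x\in\mathbb{R}:\rho(x)=\frac{|\operatorname{Im}\zeta|}{\pi}\right\}\right).$$ -/

import Mathlib

open MeasureTheory Filter Topology
open scoped NNReal ENNReal

namespace StieltjesInverse

/-- The Stieltjes transform `G_μ(z) = ∫_Γ 1 / (z - x) dμ(x)`, where `Γ` is the support of `μ`.
It is meant for `z ∉ Γ`. -/
noncomputable def stieltjes (μ : Measure ℝ) (z : ℂ) : ℂ :=
  ∫ x in μ.support, 1 / (z - (x : ℂ)) ∂μ

/-- The Joukowski transform `J(z) = (z + 1/z) / 2`. -/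
noncomputable def joukowski (z : ℂ) : ℂ := (1 / 2) * (z + 1 / z)

/-- The affine map `M_{(a,b)}`, which sends `[-1,1]` to `[a,b]`. -/
noncomputable def affineMap (a b : ℝ) (z : ℂ) : ℂ :=
  ((b : ℂ) + a) / 2 + ((b : ℂ) - a) / 2 * z

/-- The curve `γ_r(t) = G_μ(M_{(a,b)}(J(r e^{it})))`, for `0 < r < 1`, where `a = min Γ` and
`b = max Γ` are the end points of the convex hull of the support `Γ` of `μ`. -/
noncomputable def innerCurve (μ : Measure ℝ) (r t : ℝ) : ℂ :=
  stieltjes μ (affineMap (sInf μ.support) (sSup μ.support)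
    (joukowski ((r : ℂ) * Complex.exp ((t : ℂ) * Complex.I))))

/-- The boundary curve `γ_1(t) = lim_{r ↑ 1} γ_r(t)`, for `t ∈ [0, 2π]`. The limit exists for
compactly supported measures with a Hölder continuous density. -/
noncomputable def boundaryCurve (μ : Measure ℝ) (t : ℝ) : ℂ :=
  limUnder (𝓝[<] (1 : ℝ)) (fun r : ℝ => innerCurve μ r t)

/-- Two points of `A ⊆ ℝ` are equivalent if the closed interval between them lies in `A`. -/
def intervalSetoid (A : Set ℝ) : Setoid A where
  r x y := Set.uIcc (x : ℝ) (y : ℝ) ⊆ A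
  iseqv :=
    { refl := fun x => by simp
      symm := fun {x y} h => by rwa [Set.uIcc_comm]
      trans := fun {x y z} h₁ h₂ =>
        Set.uIcc_subset_uIcc_union_uIcc.trans (Set.union_subset h₁ h₂) }

/-- `C(A)`, the number of connected components of `A ⊆ ℝ`, with value `∞` if there are infinitely
many. -/
noncomputable def numComponents (A : Set ℝ) : ℕ∞ := ENat.card (Quotient (intervalSetoid A))

/-- The number of solutions `z ∈ ℂ \ Γ` of `G_μ(z) = ζ`, counted with multiplicity (possibly
infinite): the supremum, over the finite sets of solutions, of the sum of the orders of vanishing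
of `G_μ - ζ` at the points of the set. -/
noncomputable def numSolutions (μ : Measure ℝ) (ζ : ℂ) : ℕ∞ :=
  ⨆ (s : Finset ℂ) (_ : ∀ z ∈ s, z ∉ ((↑) : ℝ → ℂ) '' μ.support ∧ stieltjes μ z = ζ),
    ∑ z ∈ s, analyticOrderAt (fun w => stieltjes μ w - ζ) z

end StieltjesInverse

namespace StieltjesInverse

open Complex ComplexConjugate

/-! By conjugation symmetry let Im ζ < 0. Since ρ ≥ 0, the imaginary part of G_μ is nonnegative on
the closed lower half-plane off Γ, so every solution lies in the upper half-plane. Hölder continuity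
extends G_μ continuously to the closed upper half-plane, with imaginary part -πρ on ℝ
(`cauchyExtension`), and the boundary values where ρ ≠ 0 lie on γ_1 (`exists_boundaryCurve_eq`).
Hence F = G_μ - ζ has no real zero, and F tends to -ζ ≠ 0 at infinity.

By the argument principle (`HalfPlaneFunction.exists_boundaryArg`) the argument of F grows along ℝ
by 2πn, where n counts the zeros. Since Im F > 0 near ±∞, the argument meets 2n consecutive
multiples of π, and Im F ≠ 0 somewhere between any two of them. On ℝ, Im F = -πρ - Im ζ, so the
level set of ρ has at least 2n components (`IsBoundaryArg.two_mul_le_numComponents`).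

The argument principle is obtained without contour integrals: Blaschke factors, each worth 2π, are
divided out until a function without zeros, hence with a continuous logarithm, remains. -/

/-! ### Half-plane functions and continuous logarithms. -/

/-- Reflection of the lower half-plane onto the upper one. -/
def fold (z : ℂ) : ℂ := ⟨z.re, |z.im|⟩

lemma continuous_fold : Continuous fold := by
  have : fold = fun z : ℂ => (z.re : ℂ) + (|z.im| : ℝ) * I := by
    ext z; apply Complex.ext <;> simp [fold]
  rw [this]
  fun_prop

lemma fold_ofReal (x : ℝ) : fold x = x := by
  apply Complex.ext <;> simp [fold]

lemma fold_im_nonneg (z : ℂ) : 0 ≤ (fold z).im := abs_nonneg _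

lemma norm_fold (z : ℂ) : ‖fold z‖ = ‖z‖ := by
  simp [fold, Complex.norm_def, Complex.normSq_apply]

/-- Functions on the upper half-plane with a zero-free continuous boundary function on the real
line and with limit `h` at infinity. -/
structure HalfPlaneFunction (F : ℂ → ℂ) (h : ℂ) : Prop where
  continuous : Continuous F
  differentiableOn : DifferentiableOn ℂ F {z | 0 < z.im}
  ne_zero : ∀ x : ℝ, F x ≠ 0
  tendsto : Tendsto F (Bornology.cobounded ℂ ⊓ 𝓟 {z | 0 ≤ z.im}) (𝓝 h)

lemma isOpen_halfPlane : IsOpen {z : ℂ | 0 < z.im} := isOpen_lt continuous_const continuous_im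

lemma tendsto_fold_cobounded :
    Tendsto fold (Bornology.cobounded ℂ) (Bornology.cobounded ℂ ⊓ 𝓟 {z | 0 ≤ z.im}) := by
  refine tendsto_inf.2 ⟨?_, tendsto_principal.2 (Eventually.of_forall fold_im_nonneg)⟩
  rw [← comap_norm_atTop, tendsto_comap_iff]
  have : norm ∘ fold = (norm : ℂ → ℝ) := funext norm_fold
  rw [this]
  exact tendsto_comap

/-- A zero-free continuous function on the plane has a continuous logarithm. -/
lemma exists_continuous_log {f : ℂ → ℂ} (hf : Continuous f) (h0 : ∀ z, f z ≠ 0) :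
    ∃ L : ℂ → ℂ, Continuous L ∧ ∀ z, exp (L z) = f z := by
  obtain ⟨L, ⟨-, hL⟩, -⟩ := isCoveringMapOn_exp.existsUnique_continuousMap_lifts
    (⟨f, hf⟩ : C(ℂ, ℂ)) (a₀ := 0) (e₀ := log (f 0)) (exp_log (h0 0)) (fun z => h0 z)
  exact ⟨L, L.continuous, fun z => congrFun hL z⟩

/-- Both `k` and the constant `k b` lift the same constant map through the covering `exp`, and they
agree at `b`. -/
lemma eq_of_exp_eq_const {A : Type*} [TopologicalSpace A] [PreconnectedSpace A] {k : A → ℂ}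
    (hk : Continuous k) {c : ℂ} (hc : ∀ a, exp (k a) = c) (a b : A) : k a = k b := by
  have := isCoveringMap_exp.eq_of_comp_eq hk (continuous_const (y := k b)) (by
    ext x; simp [hc]) b rfl
  exact congrFun this a

lemma mem_slitPlane_of_tendsto {α : Type*} {l : Filter α} {f : α → ℂ} {h : ℂ} (hh : h ≠ 0)
    (hf : Tendsto f l (𝓝 h)) : ∀ᶠ x in l, f x / h ∈ slitPlane := by
  have : Tendsto (fun x => f x / h) l (𝓝 1) := by
    simpa [hh] using hf.div_const h
  exact this.eventually (isOpen_slitPlane.mem_nhds one_mem_slitPlane)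

lemma tendsto_ofReal_atTop_cobounded :
    Tendsto (fun R : ℝ => (R : ℂ)) atTop (Bornology.cobounded ℂ) := by
  rw [← comap_norm_atTop, tendsto_comap_iff]
  exact tendsto_abs_atTop_atTop.congr (fun x => by simp)

lemma tendsto_ofReal_atBot_cobounded :
    Tendsto (fun R : ℝ => (R : ℂ)) atBot (Bornology.cobounded ℂ) := by
  rw [← comap_norm_atTop, tendsto_comap_iff]
  exact tendsto_abs_atBot_atTop.congr (fun x => by simp)

/-- On a large circle f / h stays in the slit plane, so L and the principal logarithm of f / h
differ there by a constant. The increment of L from -R to R is thus that of the principal logarithm,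
which tends to 0. -/
lemma log_diff_tendsto {f L : ℂ → ℂ} {h : ℂ} (hf : Continuous f) (hh : h ≠ 0)
    (hlim : Tendsto f (Bornology.cobounded ℂ) (𝓝 h)) (hL : Continuous L) (hexp : ∀ z, exp (L z) = f z) :
    Tendsto (fun R : ℝ => L R - L (-R)) atTop (𝓝 0) := by
  have hdiv : Tendsto (fun z => log (f z / h)) (Bornology.cobounded ℂ) (𝓝 0) := by
    have : Tendsto (fun x => f x / h) (Bornology.cobounded ℂ) (𝓝 1) := by simpa [hh] using hlim.div_const h
    simpa using this.clog one_mem_slitPlane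
  have hR := tendsto_ofReal_atTop_cobounded
  have hR' : Tendsto (fun R : ℝ => -(R : ℂ)) atTop (Bornology.cobounded ℂ) := by
    simpa [Function.comp_def] using tendsto_ofReal_atBot_cobounded.comp tendsto_neg_atTop_atBot
  have key : ∀ᶠ R : ℝ in atTop, log (f R / h) - log (f (-R) / h) = L R - L (-R) := by
    have hs := mem_slitPlane_of_tendsto hh hlim
    rw [← comap_norm_atTop, (atTop_basis.comap _).eventually_iff] at hs
    obtain ⟨r, -, hr⟩ := hs
    filter_upwards [eventually_ge_atTop r, eventually_ge_atTop 0] with R hRr hR0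
    -- The upper half circle joining R to -R.
    let p : ℝ → ℂ := fun φ => R * exp (φ * I)
    have hp : Continuous p := by fun_prop
    have hpn : ∀ φ, f (p φ) / h ∈ slitPlane := fun φ => hr (by
      simp [p, abs_of_nonneg hR0, hRr])
    have hk : Continuous (fun φ => L (p φ) - log (f (p φ) / h)) :=
      (hL.comp hp).sub (((hf.comp hp).div_const h).clog hpn)
    have := eq_of_exp_eq_const hk (c := h) (fun φ => by
      have hne := slitPlane_ne_zero (hpn φ)
      rw [exp_sub, hexp, exp_log hne]
      have : f (p φ) ≠ 0 := fun h0 => hne (by simp [h0])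
      field_simp) 0 Real.pi
    simp only [p, ofReal_zero, zero_mul, exp_zero, mul_one, exp_pi_mul_I, mul_neg] at this
    linear_combination -this
  have := (hdiv.comp hR).sub (hdiv.comp hR')
  simp only [Function.comp_def, sub_zero] at this
  exact this.congr' key

/-! ### The argument principle in the half-plane. -/

/-- `θ` is a continuous argument of `F` along the real line, of total increment `2πn`. -/
structure IsBoundaryArg (F : ℂ → ℂ) (n : ℕ) (θ : ℝ → ℝ) : Prop where
  continuous : Continuous θ
  eq_norm_mul : ∀ x : ℝ, F x = ‖F x‖ * exp (θ x * I)
  tendsto : Tendsto (fun R => θ R - θ (-R)) atTop (𝓝 (2 * Real.pi * n))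

/-- Composing with `fold` gives a zero-free continuous function on the whole plane that agrees with
F on ℝ; its logarithm needs no holomorphy. -/
lemma HalfPlaneFunction.exists_boundaryArg_of_ne_zero {F : ℂ → ℂ} {h : ℂ}
    (hF : HalfPlaneFunction F h) (hh : h ≠ 0) (h0 : ∀ z : ℂ, 0 < z.im → F z ≠ 0) :
    ∃ θ, IsBoundaryArg F 0 θ := by
  have hne : ∀ z, F (fold z) ≠ 0 := fun z => by
    rcases (fold_im_nonneg z).eq_or_lt with h1 | h1
    · have : fold z = ((fold z).re : ℂ) := by apply Complex.ext <;> simp [← h1]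
      rw [this]
      exact hF.ne_zero _
    · exact h0 _ h1
  have hc := hF.continuous.comp continuous_fold
  obtain ⟨L, hL, hexp⟩ := exists_continuous_log hc hne
  have hlim := log_diff_tendsto hc hh (hF.tendsto.comp tendsto_fold_cobounded) hL hexp
  refine ⟨fun x => (L x).im, by fun_prop, fun x => ?_, ?_⟩
  · have : F x = exp (L x) := by rw [hexp, Function.comp_apply, fold_ofReal]
    rw [this, Complex.norm_exp, ofReal_exp, ← exp_add, re_add_im]
  · have := (continuous_im.tendsto _).comp hlim
    simpa [Function.comp_def] using this

lemma HalfPlaneFunction.analyticAt {F : ℂ → ℂ} {h : ℂ} (hF : HalfPlaneFunction F h) {z : ℂ}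
    (hz : 0 < z.im) : AnalyticAt ℂ F z :=
  hF.differentiableOn.analyticAt (isOpen_halfPlane.mem_nhds hz)

/-- Otherwise the identity theorem, followed by continuity, would make F vanish on ℝ. -/
lemma HalfPlaneFunction.analyticOrderAt_ne_top {F : ℂ → ℂ} {h : ℂ} (hF : HalfPlaneFunction F h)
    {z : ℂ} (hz : 0 < z.im) : analyticOrderAt F z ≠ ⊤ := by
  intro htop
  have hpre : IsPreconnected {z : ℂ | 0 < z.im} := (convex_halfSpace_im_gt 0).isPreconnected
  have h0 : Set.EqOn F 0 {z : ℂ | 0 < z.im} :=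
    AnalyticOnNhd.eqOn_zero_of_preconnected_of_eventuallyEq_zero
    (f := F) (fun w hw => hF.analyticAt hw) hpre hz (analyticOrderAt_eq_top.1 htop)
  have hcl := h0.closure hF.continuous continuous_zero
  rw [closure_setOfPred_lt_im] at hcl
  exact hF.ne_zero 0 (hcl (by simp))

/-- The nonzero limit at infinity confines the zeros to a compact set. An accumulation point cannot
be real, and in the open half-plane it would have infinite order. -/
lemma HalfPlaneFunction.finite_zeros {F : ℂ → ℂ} {h : ℂ} (hF : HalfPlaneFunction F h)
    (hh : h ≠ 0) : {z : ℂ | 0 < z.im ∧ F z = 0}.Finite := by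
  by_contra hinf
  have hK : IsCompact {z : ℂ | 0 ≤ z.im ∧ F z = 0} := by
    refine Metric.isCompact_of_isClosed_isBounded ?_ ?_
    · exact (isClosed_le continuous_const continuous_im).inter
        (isClosed_eq hF.continuous continuous_const)
    · have h1 := hF.tendsto.eventually_ne hh
      rw [eventually_inf_principal] at h1
      rw [← Bornology.isCobounded_compl_iff, Bornology.isCobounded_def]
      filter_upwards [h1] with z hz hz'
      exact hz hz'.1 hz'.2
  obtain ⟨z, hz, hacc⟩ := Set.Infinite.exists_accPt_of_subset_isCompact hinf hK
    (fun z hz => ⟨hz.1.le, hz.2⟩)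
  have hzim : 0 < z.im := by
    rcases hz.1.eq_or_lt with h1 | h1
    · have : z = (z.re : ℂ) := by apply Complex.ext <;> simp [← h1]
      exact absurd (this ▸ hz.2) (hF.ne_zero _)
    · exact h1
  refine hF.analyticOrderAt_ne_top hzim (analyticOrderAt_eq_top.2 ?_)
  refine (hF.analyticAt hzim).frequently_zero_iff_eventually_zero.1 ?_
  exact (accPt_iff_frequently_nhdsNE.1 hacc).mono fun w hw => hw.2

/-- The quotient of `F` by the Blaschke factor with zero `w`. -/
noncomputable def blaschkeQuotient (F : ℂ → ℂ) (w z : ℂ) : ℂ := dslope F w z * (z - conj w)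

/-- The factor z - conj w restores the limit at infinity, and its only zero lies in the lower
half-plane. -/
lemma HalfPlaneFunction.blaschkeQuotient {F : ℂ → ℂ} {h w : ℂ} (hF : HalfPlaneFunction F h)
    (hw : 0 < w.im) (hFw : F w = 0) : HalfPlaneFunction (blaschkeQuotient F w) h := by
  have hd : DifferentiableAt ℂ F w := (hF.analyticAt hw).differentiableAt
  refine ⟨?_, ?_, fun x => ?_, ?_⟩
  · have : Continuous (dslope F w) := by
      rw [continuous_iff_continuousAt]
      intro z
      rcases eq_or_ne z w with rfl | hz
      · exact continuousAt_dslope_same.2 hd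
      · exact (continuousAt_dslope_of_ne hz).2 hF.continuous.continuousAt
    unfold StieltjesInverse.blaschkeQuotient
    fun_prop
  · exact ((differentiableOn_dslope (isOpen_halfPlane.mem_nhds hw)).2 hF.differentiableOn).mul
      (by fun_prop)
  · have h1 : (x : ℂ) ≠ w := fun h => by simp [← h] at hw
    have h2 : (x : ℂ) ≠ conj w := fun h => by
      have := congrArg im h
      simp at this
      exact hw.ne' this
    have := sub_smul_dslope F w x
    rw [hFw, sub_zero, smul_eq_mul] at this
    refine mul_ne_zero (fun h => hF.ne_zero x ?_) (sub_ne_zero.2 h2)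
    rw [← this, h, mul_zero]
  -- The expression is (z - conj w) / (z - w).
  · have h1 : Tendsto (fun z : ℂ => 1 + (w - conj w) * (z - w)⁻¹) (Bornology.cobounded ℂ)
        (𝓝 1) := by
      have : Tendsto (fun z : ℂ => z - w) (Bornology.cobounded ℂ) (Bornology.cobounded ℂ) := by
        simp [sub_eq_add_neg]
      simpa using ((tendsto_inv₀_cobounded.comp this).const_mul (w - conj w)).const_add 1
    have h2 := hF.tendsto.mul (h1.mono_left inf_le_left)
    rw [mul_one] at h2
    refine h2.congr' ?_
    have h3 : ∀ᶠ z in Bornology.cobounded ℂ, z ≠ w :=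
      Bornology.isBounded_def.1 (Bornology.isBounded_singleton (x := w))
    filter_upwards [h3.filter_mono inf_le_left] with z hz
    have hzw := sub_ne_zero.2 hz
    have := sub_smul_dslope F w z
    rw [hFw, sub_zero, smul_eq_mul] at this
    rw [StieltjesInverse.blaschkeQuotient, ← this]
    field_simp
    ring

lemma HalfPlaneFunction.analyticOrderNatAt_eq {F : ℂ → ℂ} {h w z : ℂ}
    (hF : HalfPlaneFunction F h) (hw : 0 < w.im) (hFw : F w = 0) (hz : 0 < z.im) :
    analyticOrderNatAt F z =
      analyticOrderNatAt (StieltjesInverse.blaschkeQuotient F w) z + if z = w then 1 else 0 := by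
  have hda : AnalyticAt ℂ (dslope F w) z :=
    ((differentiableOn_dslope (isOpen_halfPlane.mem_nhds hw)).2 hF.differentiableOn).analyticAt
      (isOpen_halfPlane.mem_nhds hz)
  have hFeq : F = (fun u => u - w) * dslope F w := by
    ext u
    have := sub_smul_dslope F w u
    rw [hFw, sub_zero, smul_eq_mul] at this
    exact this.symm
  have hl : AnalyticAt ℂ (fun u : ℂ => u - w) z := by fun_prop
  have hr : AnalyticAt ℂ (fun u : ℂ => u - conj w) z := by fun_prop
  have h1 : analyticOrderAt (fun u : ℂ => u - conj w) z = 0 := by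
    refine hr.analyticOrderAt_eq_zero.2 (sub_ne_zero.2 fun h => ?_)
    have := congrArg im h
    simp at this
    linarith
  have h2 : analyticOrderAt (fun u : ℂ => u - w) z = if z = w then 1 else 0 := by
    split_ifs with h
    · subst h; exact analyticOrderAt_id_sub_const_self
    · exact hl.analyticOrderAt_eq_zero.2 (sub_ne_zero.2 h)
  have h3 : analyticOrderAt (StieltjesInverse.blaschkeQuotient F w) z
      = analyticOrderAt (dslope F w) z := by
    have := analyticOrderAt_mul hda hr
    rw [h1, add_zero] at this
    exact this
  have h4 : analyticOrderAt F z = analyticOrderAt (StieltjesInverse.blaschkeQuotient F w) z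
      + if z = w then 1 else 0 := by
    conv_lhs => rw [hFeq, analyticOrderAt_mul hl hda, h2]
    rw [h3, add_comm]
  rw [analyticOrderNatAt, analyticOrderNatAt, h4, ENat.toNat_add]
  · split_ifs <;> simp
  · exact (hF.blaschkeQuotient hw hFw).analyticOrderAt_ne_top hz
  · split_ifs <;> simp

lemma tendsto_arg_ofReal_add (c : ℂ) :
    Tendsto (fun R : ℝ => arg (R + c)) atTop (𝓝 0) := by
  have h1 : Tendsto (fun R : ℝ => 1 + c * ((R⁻¹ : ℝ) : ℂ)) atTop (𝓝 1) := by
    have := (continuous_ofReal.tendsto _).comp (tendsto_inv_atTop_zero (𝕜 := ℝ))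
    simpa using (this.const_mul c).const_add 1
  have h2 := (continuousAt_arg one_mem_slitPlane).tendsto.comp h1
  rw [arg_one] at h2
  refine h2.congr' ?_
  filter_upwards [eventually_gt_atTop 0] with R hR
  rw [Function.comp_apply, ← arg_real_mul _ hR]
  congr 1
  push_cast
  have : (R : ℂ) ≠ 0 := by exact_mod_cast hR.ne'
  field_simp

/-- For real x and u = x - w, the removed factor u / conj u has modulus 1 and argument 2 arg u. As u
runs along a line in the lower half-plane, arg u rises from -π to 0, which adds 2π in total. -/
lemma IsBoundaryArg.add_arg {F : ℂ → ℂ} {w : ℂ} {n : ℕ} {θ : ℝ → ℝ}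
    (hθ : IsBoundaryArg (blaschkeQuotient F w) n θ) (hw : 0 < w.im) (hFw : F w = 0) :
    IsBoundaryArg F (n + 1) (fun x => θ x + 2 * arg (x - w)) := by
  refine ⟨?_, fun x => ?_, ?_⟩
  · have : Continuous fun x : ℝ => arg (x - w) := by
      rw [continuous_iff_continuousAt]
      intro x
      refine (continuousAt_arg ?_).comp (by fun_prop)
      exact mem_slitPlane_iff.2 (Or.inr (by simpa using hw.ne'))
    exact hθ.continuous.add (this.const_mul 2)
  · have h1 := sub_smul_dslope F w x
    rw [hFw, sub_zero, smul_eq_mul] at h1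
    have h2 := hθ.eq_norm_mul x
    set u : ℂ := x - w with hu
    have hu0 : u ≠ 0 := fun h => by
      have := congrArg im h
      simp [hu] at this
      linarith
    have hcu : (x : ℂ) - conj w = conj u := by simp [hu]
    have hn : ‖blaschkeQuotient F w x‖ = ‖F x‖ := by
      rw [blaschkeQuotient, hcu, norm_mul, RCLike.norm_conj, ← h1, norm_mul, mul_comm]
    rw [hn] at h2
    have h3 : blaschkeQuotient F w x * u = F x * conj u := by
      rw [blaschkeQuotient, hcu, ← h1]; ring
    have h4 : conj u = ‖u‖ * exp (-(arg u * I)) := by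
      conv_lhs => rw [← norm_mul_exp_arg_mul_I u]
      rw [map_mul, conj_ofReal, ← exp_conj, map_mul, conj_ofReal, conj_I, mul_neg]
    have h5 : conj u ≠ 0 := by simpa using hu0
    refine mul_right_cancel₀ h5 ?_
    rw [← h3, h2, h4]
    conv_lhs => rw [← norm_mul_exp_arg_mul_I u]
    have : ((θ x + 2 * arg u : ℝ) : ℂ) * I = θ x * I + arg u * I + arg u * I := by
      push_cast; ring
    rw [this, exp_add, exp_add, exp_neg]
    field_simp [exp_ne_zero]
  · have h1 := tendsto_arg_ofReal_add (-w)
    have h2 := tendsto_arg_ofReal_add w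
    have h3 := hθ.tendsto.add (((h1.sub h2).add_const Real.pi).const_mul 2)
    convert h3 using 2 with R
    · have : ((-R : ℝ) : ℂ) - w = -(R + w) := by push_cast; ring
      rw [this, arg_neg_eq_arg_sub_pi_of_im_pos (by simpa using hw), ← sub_eq_add_neg]
      ring
    · push_cast; ring

/-- The argument principle for the half-plane. -/
lemma HalfPlaneFunction.exists_boundaryArg {h : ℂ} (hh : h ≠ 0) (s : Finset ℂ)
    (hs : ∀ z ∈ s, 0 < z.im) (n : ℕ) : ∀ {F : ℂ → ℂ}, HalfPlaneFunction F h →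
    (∀ z : ℂ, 0 < z.im → F z = 0 → z ∈ s) → ∑ z ∈ s, analyticOrderNatAt F z = n →
    ∃ θ, IsBoundaryArg F n θ := by
  induction n with
  | zero =>
    intro F hF hz hsum
    refine hF.exists_boundaryArg_of_ne_zero hh fun z hz0 hFz => ?_
    have h1 := Finset.sum_eq_zero_iff.1 hsum z (hz z hz0 hFz)
    have h2 := Nat.cast_analyticOrderNatAt (hF.analyticOrderAt_ne_top hz0)
    rw [h1, Nat.cast_zero] at h2
    exact (hF.analyticAt hz0).analyticOrderAt_eq_zero.1 h2.symm hFz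
  | succ n ih =>
    intro F hF hz hsum
    obtain ⟨w, hws, hw0⟩ : ∃ w ∈ s, analyticOrderNatAt F w ≠ 0 :=
      Finset.exists_ne_zero_of_sum_ne_zero (by omega)
    have hw := hs w hws
    have hFw := apply_eq_zero_of_analyticOrderNatAt_ne_zero hw0
    obtain ⟨θ, hθ⟩ := ih (hF.blaschkeQuotient hw hFw) (fun z hz0 hFz => by
        refine hz z hz0 ?_
        have := sub_smul_dslope F w z
        rw [hFw, sub_zero, smul_eq_mul] at this
        rcases mul_eq_zero.1 hFz with h1 | h1
        · rw [← this, h1, mul_zero]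
        · have := congrArg im h1
          simp at this
          linarith) (by
        rw [Finset.sum_congr rfl (fun z hzs => hF.analyticOrderNatAt_eq hw hFw (hs z hzs)),
          Finset.sum_add_distrib, Finset.sum_ite_eq', if_pos hws] at hsum
        omega)
    exact ⟨_, hθ.add_arg hw hFw⟩

/-! ### From the increment of the argument to components. -/

lemma exists_mem_Ioo_of_sin_pos {u : ℝ} (hu : 0 < Real.sin u) :
    ∃ j : ℤ, j * (2 * Real.pi) < u ∧ u < j * (2 * Real.pi) + Real.pi := by
  have hpi := Real.pi_pos
  have h1 := Int.floor_le (u / (2 * Real.pi))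
  have h2 := Int.lt_floor_add_one (u / (2 * Real.pi))
  set j := ⌊u / (2 * Real.pi)⌋
  rw [le_div_iff₀ (by positivity)] at h1
  rw [div_lt_iff₀ (by positivity)] at h2
  have h3 := Real.sin_sub_int_mul_two_pi u j
  refine ⟨j, lt_of_le_of_ne h1 fun h => ?_, ?_⟩
  · rw [← h3, h, sub_self, Real.sin_zero] at hu
    exact hu.false
  · by_contra! h
    have h4 := Real.sin_nonpos_of_nonpos_of_neg_pi_le
      (x := u - j * (2 * Real.pi) - 2 * Real.pi) (by linarith) (by linarith)
    rw [Real.sin_sub_two_pi, h3] at h4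
    linarith

lemma IsBoundaryArg.two_mul_le_numComponents {F : ℂ → ℂ} {h : ℂ} {n : ℕ} {θ : ℝ → ℝ}
    (hF : HalfPlaneFunction F h) (hh : 0 < h.im) (hθ : IsBoundaryArg F n θ) :
    2 * (n : ℕ∞) ≤ numComponents {x : ℝ | (F x).im = 0} := by
  have hpi := Real.pi_pos
  have him : ∀ x : ℝ, (F x).im = ‖F x‖ * Real.sin (θ x) := fun x => by
    conv_lhs => rw [hθ.eq_norm_mul x, im_ofReal_mul, exp_ofReal_mul_I_im]
  have hpos : ∀ x : ℝ, 0 < ‖F x‖ := fun x => norm_pos_iff.2 (hF.ne_zero x)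
  have him0 : ∀ x : ℝ, (F x).im = 0 ↔ Real.sin (θ x) = 0 := fun x => by
    rw [him, mul_eq_zero, or_iff_right (hpos x).ne']
  have hend : ∀ᶠ z in Bornology.cobounded ℂ ⊓ 𝓟 {z : ℂ | 0 ≤ z.im}, 0 < (F z).im :=
    ((continuous_im.tendsto h).comp hF.tendsto).eventually_const_lt hh
  have hRight : Tendsto (fun R : ℝ => (R : ℂ)) atTop
      (Bornology.cobounded ℂ ⊓ 𝓟 {z : ℂ | 0 ≤ z.im}) := by
    refine tendsto_inf.2 ⟨tendsto_ofReal_atTop_cobounded,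
      tendsto_principal.2 (Eventually.of_forall fun R => by simp)⟩
  have hLeft : Tendsto (fun R : ℝ => ((-R : ℝ) : ℂ)) atTop
      (Bornology.cobounded ℂ ⊓ 𝓟 {z : ℂ | 0 ≤ z.im}) := by
    refine tendsto_inf.2 ⟨tendsto_ofReal_atBot_cobounded.comp tendsto_neg_atTop_atBot,
      tendsto_principal.2 (Eventually.of_forall fun R => by simp)⟩
  obtain ⟨R, hR0, hR1, hR2, hR3⟩ := ((eventually_ge_atTop (0 : ℝ)).and
    ((hRight.eventually hend).and ((hLeft.eventually hend).and
    (hθ.tendsto.eventually_const_lt (u := 2 * Real.pi * n - Real.pi) (by linarith))))).exists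
  rw [him, mul_pos_iff_of_pos_left (hpos _)] at hR1 hR2
  obtain ⟨j, hj1, hj2⟩ := exists_mem_Ioo_of_sin_pos hR2
  -- θ R exceeds (2(j + n) - 1)π, and the sine is nonpositive from there up to 2(j + n)π.
  have hup : (j + n : ℤ) * (2 * Real.pi) < θ R := by
    by_contra! hle
    have h4 := Real.sin_nonpos_of_nonpos_of_neg_pi_le
      (x := θ R - (j + n : ℤ) * (2 * Real.pi)) (by linarith) (by push_cast; linarith)
    rw [Real.sin_sub_int_mul_two_pi] at h4
    linarith
  push_cast at hup
  have hivt := intermediate_value_Icc (by linarith : -R ≤ R) hθ.continuous.continuousOn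
  -- The 2n values (2j + 1)π, ..., (2j + 2n)π all lie between θ(-R) and θ(R).
  have hex : ∀ k : Fin (2 * n), ∃ x : ℝ, θ x = (2 * j + 1 + (k : ℕ) : ℤ) * Real.pi := fun k => by
    have hk : ((k : ℕ) : ℝ) + 1 ≤ 2 * n := by exact_mod_cast k.2
    have hk' := mul_le_mul_of_nonneg_right hk hpi.le
    have hk0 : 0 ≤ ((k : ℕ) : ℝ) * Real.pi := by positivity
    obtain ⟨x, -, hx⟩ := hivt (a := (2 * j + 1 + (k : ℕ) : ℤ) * Real.pi)
      ⟨by push_cast; linarith, by push_cast; linarith⟩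
    exact ⟨x, hx⟩
  choose x hx using hex
  have hxA : ∀ k, x k ∈ {x : ℝ | (F x).im = 0} := fun k => by
    rw [Set.mem_ofPred_eq, him0, hx, Real.sin_int_mul_pi]
  have hsep : ∀ k l : Fin (2 * n), k < l → ¬ Set.uIcc (x k) (x l) ⊆ {x : ℝ | (F x).im = 0} := by
    intro k l hkl hsub
    have hkl' : ((k : ℕ) : ℝ) + 1 ≤ (l : ℕ) := by exact_mod_cast hkl
    have hkl'' := mul_le_mul_of_nonneg_right hkl' hpi.le
    -- Between two of these values θ takes an odd multiple of π/2, where the sine is not 0.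
    have hmem : (2 * j + 1 + (k : ℕ) : ℤ) * Real.pi + Real.pi / 2 ∈
        Set.uIcc (θ (x k)) (θ (x l)) := by
      rw [hx, hx]
      exact Set.Icc_subset_uIcc ⟨by linarith, by push_cast; linarith⟩
    obtain ⟨y, hy, hy'⟩ := intermediate_value_uIcc hθ.continuous.continuousOn hmem
    have := (him0 y).1 (hsub hy)
    rw [hy', Real.sin_add_pi_div_two] at this
    have h1 := Real.sin_sq_add_cos_sq ((2 * j + 1 + (k : ℕ) : ℤ) * Real.pi)
    rw [this, Real.sin_int_mul_pi] at h1
    norm_num at h1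
  let g : Fin (2 * n) → Quotient (intervalSetoid {x : ℝ | (F x).im = 0}) :=
    fun k => Quotient.mk _ ⟨x k, hxA k⟩
  have hg : Function.Injective g := fun k l hkl => by
    have hrel : Set.uIcc (x k) (x l) ⊆ {x : ℝ | (F x).im = 0} := Quotient.exact hkl
    rcases lt_trichotomy k l with h1 | h1 | h1
    · exact absurd hrel (hsep k l h1)
    · exact h1
    · exact absurd (Set.uIcc_comm (x k) (x l) ▸ hrel) (hsep l k h1)
  have := ENat.card_le_card_of_injective hg
  simpa [numComponents] using this

lemma HalfPlaneFunction.exists_bound {F : ℂ → ℂ} {h : ℂ} (hF : HalfPlaneFunction F h)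
    (hh : 0 < h.im) : ∃ n : ℕ, 2 * (n : ℕ∞) ≤ numComponents {x : ℝ | (F x).im = 0} ∧
      ∀ s : Finset ℂ, (∀ z ∈ s, 0 < z.im ∧ F z = 0) → ∑ z ∈ s, analyticOrderAt F z ≤ n := by
  have hh0 : h ≠ 0 := by rintro rfl; simp at hh
  have hfin := hF.finite_zeros hh0
  obtain ⟨θ, hθ⟩ := HalfPlaneFunction.exists_boundaryArg hh0 hfin.toFinset
    (fun z hz => ((hfin.mem_toFinset).1 hz).1) _ hF
    (fun z h1 h2 => (hfin.mem_toFinset).2 ⟨h1, h2⟩) rfl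
  refine ⟨_, hθ.two_mul_le_numComponents hF hh, fun s hs => ?_⟩
  have hsub : s ⊆ hfin.toFinset := fun z hz => (hfin.mem_toFinset).2 (hs z hz)
  calc ∑ z ∈ s, analyticOrderAt F z = ∑ z ∈ s, (analyticOrderNatAt F z : ℕ∞) :=
        Finset.sum_congr rfl fun z hz =>
          (Nat.cast_analyticOrderNatAt (hF.analyticOrderAt_ne_top (hs z hz).1)).symm
    _ ≤ ∑ z ∈ hfin.toFinset, (analyticOrderNatAt F z : ℕ∞) :=
        Finset.sum_le_sum_of_subset hsub
    _ = _ := by push_cast; rfl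

/-! ### Boundary values of the Cauchy integral. -/

/-- The Cauchy integral of a density on the real line. -/
noncomputable def cauchyIntegral (ρ : ℝ → ℝ) (z : ℂ) : ℂ := ∫ t, (ρ t : ℂ) * (1 / (z - t))

/-- The regularized real part of the Cauchy integral at `x + iy`. -/
noncomputable def hilbertPart (ρ : ℝ → ℝ) (x y : ℝ) : ℝ :=
  ∫ s in Set.Ioi 0, (ρ (x - s) - ρ (x + s)) * (s / (s ^ 2 + y ^ 2))

/-- The Poisson integral of `ρ` at `x + iy`, up to the factor `π`. -/
noncomputable def poissonPart (ρ : ℝ → ℝ) (x y : ℝ) : ℝ := ∫ u, ρ (x - y * u) * (1 + u ^ 2)⁻¹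

/-- The continuous extension of the Cauchy integral from the open to the closed upper
half-plane. -/
noncomputable def cauchyExtension (ρ : ℝ → ℝ) (z : ℂ) : ℂ :=
  hilbertPart ρ z.re z.im - poissonPart ρ z.re z.im * I

variable {ρ : ℝ → ℝ}

/-- In the variable u the kernel no longer depends on y, so dominated convergence works up to y = 0.
-/
lemma continuous_poissonPart (hρ : Continuous ρ) (hs : HasCompactSupport ρ) :
    Continuous fun p : ℝ × ℝ => poissonPart ρ p.1 p.2 := by
  obtain ⟨M, hM⟩ := hρ.bounded_above_of_compact_support hs
  refine continuous_of_dominated (bound := fun u => M * (1 + u ^ 2)⁻¹) (fun p => ?_) (fun p => ?_)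
    (integrable_inv_one_add_sq.const_mul M) ?_
  · refine Continuous.aestronglyMeasurable ?_
    refine (by fun_prop : Continuous fun u => ρ (p.1 - p.2 * u)).mul (Continuous.inv₀ (by fun_prop)
      fun u => by positivity)
  · refine Eventually.of_forall fun u => ?_
    rw [norm_mul, Real.norm_of_nonneg (by positivity : 0 ≤ (1 + u ^ 2)⁻¹)]
    gcongr
    exact hM _
  · exact Eventually.of_forall fun u => by fun_prop

lemma exists_bound_support (hs : HasCompactSupport ρ) :
    ∃ X : ℝ, 0 < X ∧ ∀ t, ρ t ≠ 0 → |t| ≤ X := by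
  obtain ⟨X, hX⟩ := hs.isCompact.isBounded.exists_norm_le
  exact ⟨max X 1, by positivity, fun t ht =>
    (hX t (subset_tsupport _ ht)).trans (le_max_left _ _)⟩

/-- By Hölder continuity the symmetric difference is O(s^α), which bounds the integrand by a
multiple of s^(α-1) uniformly in y; this is integrable at 0. -/
lemma continuous_hilbertPart (hρ : Continuous ρ) (hs : HasCompactSupport ρ) {C α : ℝ≥0}
    (hα : 0 < α) (hh : HolderWith C α ρ) :
    Continuous fun p : ℝ × ℝ => hilbertPart ρ p.1 p.2 := by
  obtain ⟨X, hX0, hX⟩ := exists_bound_support hs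
  rw [continuous_iff_continuousAt]
  rintro ⟨x₀, y₀⟩
  -- For x within 1 of x₀ and s > T, both x - s and x + s lie outside the support.
  set T : ℝ := X + |x₀| + 1 with hT
  have hT0 : 0 ≤ T := by positivity
  have hvan : ∀ x s : ℝ, |x - x₀| < 1 → T < s → ρ (x - s) = 0 ∧ ρ (x + s) = 0 := by
    intro x s hx hsT
    have h1 := abs_lt.1 hx
    have h2 := neg_abs_le x₀
    have h3 := le_abs_self x₀
    constructor
    · by_contra h
      have := abs_le.1 (hX _ h)
      linarith
    · by_contra h
      have := abs_le.1 (hX _ h)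
      linarith
  refine continuousAt_of_dominated (bound := (Set.Ioc 0 T).indicator
    fun s => C * 2 ^ (α : ℝ) * s ^ ((α : ℝ) - 1)) ?_ ?_ ?_ ?_
  · refine Eventually.of_forall fun p => ContinuousOn.aestronglyMeasurable ?_ measurableSet_Ioi
    refine (by fun_prop : Continuous fun s => ρ (p.1 - s) - ρ (p.1 + s)).continuousOn.mul
      (ContinuousOn.div (by fun_prop) (by fun_prop) fun s hs => ?_)
    have : (0 : ℝ) < s := hs
    positivity
  · have h1 : ∀ᶠ p : ℝ × ℝ in 𝓝 (x₀, y₀), |p.1 - x₀| < 1 := by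
      have : ContinuousAt (fun p : ℝ × ℝ => |p.1 - x₀|) (x₀, y₀) := by fun_prop
      exact this.eventually_lt_const (by simp)
    filter_upwards [h1] with p hp
    refine (ae_restrict_iff' measurableSet_Ioi).2 (Eventually.of_forall fun s hs => ?_)
    have hs0 : (0 : ℝ) < s := hs
    by_cases hsT : s ≤ T
    · rw [Set.indicator_of_mem (show s ∈ Set.Ioc 0 T from ⟨hs0, hsT⟩), norm_mul]
      have h2 : ‖ρ (p.1 - s) - ρ (p.1 + s)‖ ≤ C * (2 * s) ^ (α : ℝ) := by
        rw [← dist_eq_norm]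
        refine (hh.dist_le _ _).trans_eq ?_
        congr 2
        rw [Real.dist_eq, show p.1 - s - (p.1 + s) = -(2 * s) by ring, abs_neg,
          abs_of_pos (by positivity)]
      have h3 : ‖s / (s ^ 2 + p.2 ^ 2)‖ ≤ s⁻¹ := by
        rw [Real.norm_of_nonneg (by positivity), div_le_iff₀ (by positivity), inv_mul_eq_div,
          le_div_iff₀ hs0]
        nlinarith [sq_nonneg p.2]
      calc _ ≤ (C * (2 * s) ^ (α : ℝ)) * s⁻¹ := by gcongr
        _ = _ := by
          rw [Real.mul_rpow (by norm_num) hs0.le, Real.rpow_sub_one hs0.ne']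
          ring
    · obtain ⟨h2, h3⟩ := hvan p.1 s hp (not_le.1 hsT)
      rw [h2, h3, Set.indicator_of_notMem (fun h => hsT h.2)]
      simp
  · refine Integrable.restrict ?_
    rw [integrable_indicator_iff measurableSet_Ioc]
    refine Integrable.const_mul ?_ _
    have := intervalIntegral.intervalIntegrable_rpow' (a := 0) (b := T) (r := (α : ℝ) - 1)
      (by have : (0 : ℝ) < α := by exact_mod_cast hα
          linarith)
    rwa [intervalIntegrable_iff_integrableOn_Ioc_of_le hT0] at this
  · refine (ae_restrict_iff' measurableSet_Ioi).2 (Eventually.of_forall fun s hs => ?_)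
    have hs0 : (0 : ℝ) < s := hs
    refine Continuous.continuousAt ?_
    refine (by fun_prop : Continuous fun p : ℝ × ℝ => ρ (p.1 - s) - ρ (p.1 + s)).mul
      (Continuous.div (by fun_prop) (by fun_prop) fun p => by positivity)

lemma continuous_cauchyExtension (hρ : Continuous ρ) (hs : HasCompactSupport ρ) {C α : ℝ≥0}
    (hα : 0 < α) (hh : HolderWith C α ρ) : Continuous (cauchyExtension ρ) := by
  have h1 := (continuous_hilbertPart hρ hs hα hh).comp
    (continuous_re.prodMk continuous_im)
  have h2 := (continuous_poissonPart hρ hs).comp (continuous_re.prodMk continuous_im)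
  exact (continuous_ofReal.comp h1).sub ((continuous_ofReal.comp h2).mul continuous_const)

lemma cauchyExtension_ofReal_im (x : ℝ) : (cauchyExtension ρ x).im = -(Real.pi * ρ x) := by
  simp [cauchyExtension, poissonPart, integral_const_mul, integral_univ_inv_one_add_sq, mul_comm]

lemma sub_ofReal_ne_zero {z : ℂ} (hz : z.im ≠ 0) (t : ℝ) : z - t ≠ 0 := fun h => by
  have := congrArg im h
  simp at this
  exact hz this

lemma integrable_cauchy (hρ : Continuous ρ) (hs : HasCompactSupport ρ) {z : ℂ} (hz : z.im ≠ 0) :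
    Integrable fun t : ℝ => (ρ t : ℂ) * (1 / (z - t)) := by
  refine Continuous.integrable_of_hasCompactSupport ?_ ?_
  · exact (by fun_prop : Continuous fun t => (ρ t : ℂ)).mul
      (Continuous.div (by fun_prop) (by fun_prop) (sub_ofReal_ne_zero hz))
  · exact (hs.comp_left (g := fun r : ℝ => (r : ℂ)) ofReal_zero).mul_right

lemma ofReal_mul_one_div_re (r t : ℝ) (z : ℂ) :
    ((r : ℂ) * (1 / (z - t))).re = r * ((z.re - t) / ((z.re - t) ^ 2 + z.im ^ 2)) := by
  rw [re_ofReal_mul, one_div, inv_re]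
  simp [normSq_apply, sq]

lemma ofReal_mul_one_div_im (r t : ℝ) (z : ℂ) :
    ((r : ℂ) * (1 / (z - t))).im = r * (-z.im / ((z.re - t) ^ 2 + z.im ^ 2)) := by
  rw [im_ofReal_mul, one_div, inv_im]
  simp [normSq_apply, sq]

/-- After t = x - s the kernel is odd in s, so the negative half-line folds onto the positive one.
-/
lemma cauchyIntegral_re (hρ : Continuous ρ) (hs : HasCompactSupport ρ) {z : ℂ} (hz : 0 < z.im) :
    (cauchyIntegral ρ z).re = hilbertPart ρ z.re z.im := by
  have hint := integrable_cauchy hρ hs hz.ne'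
  have hre : Integrable fun t => ρ t * ((z.re - t) / ((z.re - t) ^ 2 + z.im ^ 2)) := by
    simpa only [RCLike.re_eq_complex_re, ofReal_mul_one_div_re] using hint.re
  have h1 : (cauchyIntegral ρ z).re =
      ∫ t, ρ t * ((z.re - t) / ((z.re - t) ^ 2 + z.im ^ 2)) := by
    have := integral_re hint
    simp only [RCLike.re_eq_complex_re, ofReal_mul_one_div_re] at this
    exact this.symm
  rw [h1]
  have h2 := hre.comp_sub_left z.re
  rw [← integral_sub_left_eq_self _ volume z.re]
  simp only [sub_sub_cancel] at h2 ⊢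
  rw [← intervalIntegral.integral_Iic_add_Ioi (b := 0) h2.integrableOn h2.integrableOn,
    ← neg_zero, ← integral_comp_neg_Ioi, neg_zero, add_comm, hilbertPart, ← integral_add]
  · refine setIntegral_congr_fun measurableSet_Ioi fun s _ => ?_
    simp only [sub_neg_eq_add, neg_sq]
    ring
  · exact h2.integrableOn
  · exact h2.comp_neg.integrableOn

/-- Substitute t = x - y u. -/
lemma cauchyIntegral_im (hρ : Continuous ρ) (hs : HasCompactSupport ρ) {z : ℂ} (hz : 0 < z.im) :
    (cauchyIntegral ρ z).im = -poissonPart ρ z.re z.im := by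
  have hint := integrable_cauchy hρ hs hz.ne'
  have h1 : (cauchyIntegral ρ z).im =
      ∫ t, ρ t * (-z.im / ((z.re - t) ^ 2 + z.im ^ 2)) := by
    have := integral_im hint
    simp only [RCLike.im_eq_complex_im, ofReal_mul_one_div_im] at this
    exact this.symm
  rw [h1, ← integral_sub_left_eq_self _ volume z.re]
  simp only [sub_sub_cancel]
  have h2 := Measure.integral_comp_mul_left
    (fun s => ρ (z.re - s) * (-z.im / (s ^ 2 + z.im ^ 2))) z.im
  rw [abs_of_pos (inv_pos.2 hz), smul_eq_mul, eq_inv_mul_iff_mul_eq₀ hz.ne'] at h2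
  rw [← h2, ← integral_const_mul, poissonPart, ← integral_neg]
  refine integral_congr_ae (Eventually.of_forall fun u => ?_)
  have : (1 + u ^ 2) ≠ 0 := by positivity
  have h3 : (z.im * u) ^ 2 + z.im ^ 2 = z.im ^ 2 * (1 + u ^ 2) := by ring
  simp only [h3]
  field_simp

lemma cauchyExtension_eq (hρ : Continuous ρ) (hs : HasCompactSupport ρ) {z : ℂ} (hz : 0 < z.im) :
    cauchyExtension ρ z = cauchyIntegral ρ z := by
  apply Complex.ext
  · simp [cauchyExtension, cauchyIntegral_re hρ hs hz]
  · simp [cauchyExtension, cauchyIntegral_im hρ hs hz]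

lemma abs_im_le_norm_sub (z : ℂ) (t : ℝ) : |z.im| ≤ ‖z - t‖ := by
  simpa using abs_im_le_norm (z - t)

lemma differentiableAt_cauchyIntegral (hρ : Continuous ρ) (hs : HasCompactSupport ρ) {z₀ : ℂ}
    (hz₀ : 0 < z₀.im) : DifferentiableAt ℂ (cauchyIntegral ρ) z₀ := by
  set r := z₀.im / 2 with hr
  have hr0 : 0 < r := by positivity
  have him : ∀ z ∈ Metric.ball z₀ r, r < z.im := fun z hz => by
    have h1 := (abs_im_le_norm (z - z₀)).trans_lt (mem_ball_iff_norm.1 hz)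
    rw [sub_im, abs_lt] at h1
    linarith
  have hint : Integrable ρ := hρ.integrable_of_hasCompactSupport hs
  refine (hasDerivAt_integral_of_dominated_loc_of_deriv_le (μ := volume)
    (F := fun z t => (ρ t : ℂ) * (1 / (z - t))) (F' := fun z t => (ρ t : ℂ) * (-1 / (z - t) ^ 2))
    (bound := fun t => ‖ρ t‖ * (r ^ 2)⁻¹) (Metric.ball_mem_nhds z₀ hr0) ?_
    (integrable_cauchy hρ hs hz₀.ne') ?_ ?_ (hint.norm.mul_const _) ?_).2.differentiableAt
  · filter_upwards [isOpen_halfPlane.mem_nhds hz₀] with z hz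
    exact (integrable_cauchy hρ hs (ne_of_gt hz)).aestronglyMeasurable
  · refine Continuous.aestronglyMeasurable ?_
    exact (by fun_prop : Continuous fun t => (ρ t : ℂ)).mul
      (Continuous.div (by fun_prop) (by fun_prop) fun t =>
        pow_ne_zero 2 (sub_ofReal_ne_zero hz₀.ne' t))
  · refine Eventually.of_forall fun t z hz => ?_
    have h1 := (him z hz).le.trans ((le_abs_self _).trans (abs_im_le_norm_sub z t))
    rw [norm_mul, norm_div, norm_neg, norm_one, norm_pow, norm_real, one_div]
    gcongr
  · refine Eventually.of_forall fun t z hz => ?_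
    have h1 := sub_ofReal_ne_zero (hr0.trans (him z hz)).ne' t
    have h2 := (((hasDerivAt_id z).sub_const (t : ℂ)).inv h1).const_mul (ρ t : ℂ)
    simpa using h2

/-- The product form is trivial for ‖z‖ ≤ X and is a closed condition, so the bound will pass to the
boundary. -/
lemma norm_cauchyIntegral_mul_le (hρ : Continuous ρ) (hs : HasCompactSupport ρ) {X : ℝ}
    (hX : ∀ t, ρ t ≠ 0 → |t| ≤ X) (z : ℂ) :
    ‖cauchyIntegral ρ z‖ * (‖z‖ - X) ≤ ∫ t, ‖ρ t‖ := by
  have hM : 0 ≤ ∫ t, ‖ρ t‖ := integral_nonneg fun t => norm_nonneg _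
  rcases le_or_gt (‖z‖ - X) 0 with h0 | h0
  · exact (mul_nonpos_of_nonneg_of_nonpos (norm_nonneg _) h0).trans hM
  rw [← le_div_iff₀ h0, ← integral_div]
  refine norm_integral_le_of_norm_le
    (((hρ.integrable_of_hasCompactSupport hs).norm).div_const _) (Eventually.of_forall fun t => ?_)
  rw [norm_mul, norm_real, norm_div, norm_one, mul_one_div]
  by_cases ht : ρ t = 0
  · simp [ht]
  have h1 := hX t ht
  have h2 : ‖z‖ - X ≤ ‖z - t‖ := by
    have := norm_sub_norm_le z (t : ℂ)
    rw [norm_real, Real.norm_eq_abs] at this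
    linarith
  gcongr

lemma tendsto_cauchyExtension (hρ : Continuous ρ) (hs : HasCompactSupport ρ)
    (hc : Continuous (cauchyExtension ρ)) :
    Tendsto (cauchyExtension ρ) (Bornology.cobounded ℂ ⊓ 𝓟 {z | 0 ≤ z.im}) (𝓝 0) := by
  obtain ⟨X, -, hX⟩ := exists_bound_support hs
  have hle : ∀ z : ℂ, 0 ≤ z.im → ‖cauchyExtension ρ z‖ * (‖z‖ - X) ≤ ∫ t, ‖ρ t‖ := by
    have hcl : IsClosed {z : ℂ | ‖cauchyExtension ρ z‖ * (‖z‖ - X) ≤ ∫ t, ‖ρ t‖} :=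
      isClosed_le (by fun_prop) continuous_const
    have hsub : {z : ℂ | 0 < z.im} ⊆
        {z : ℂ | ‖cauchyExtension ρ z‖ * (‖z‖ - X) ≤ ∫ t, ‖ρ t‖} := fun z hz => by
      rw [Set.mem_ofPred_eq, cauchyExtension_eq hρ hs hz]
      exact norm_cauchyIntegral_mul_le hρ hs hX z
    have := closure_minimal hsub hcl
    rw [closure_setOfPred_lt_im] at this
    exact fun z hz => this hz
  have hnorm : Tendsto (fun z : ℂ => ‖z‖ - X) (Bornology.cobounded ℂ) atTop :=
    tendsto_atTop_add_const_right _ _ tendsto_norm_cobounded_atTop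
  have hlim : Tendsto (fun z : ℂ => (∫ t, ‖ρ t‖) / (‖z‖ - X)) (Bornology.cobounded ℂ) (𝓝 0) :=
    tendsto_const_nhds.div_atTop hnorm
  refine squeeze_zero_norm' ?_ (hlim.mono_left inf_le_left)
  rw [eventually_inf_principal]
  filter_upwards [hnorm.eventually_gt_atTop 0] with z hz hz'
  rw [le_div_iff₀ hz]
  exact hle z hz'

lemma halfPlaneFunction_cauchyExtension (hρ : Continuous ρ) (hs : HasCompactSupport ρ)
    {C α : ℝ≥0} (hα : 0 < α) (hh : HolderWith C α ρ) {ζ : ℂ}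
    (hζ : ∀ x : ℝ, cauchyExtension ρ x ≠ ζ) :
    HalfPlaneFunction (fun z => cauchyExtension ρ z - ζ) (-ζ) := by
  have hc := continuous_cauchyExtension hρ hs hα hh
  refine ⟨by fun_prop, fun z hz => ?_, fun x => sub_ne_zero.2 (hζ x), ?_⟩
  · have h1 := (differentiableAt_cauchyIntegral hρ hs hz).sub_const ζ
    refine (h1.congr_of_eventuallyEq ?_).differentiableWithinAt
    filter_upwards [isOpen_halfPlane.mem_nhds hz] with w hw
    rw [cauchyExtension_eq hρ hs hw]
  · simpa using (tendsto_cauchyExtension hρ hs hc).sub_const ζ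

/-! ### The Stieltjes transform and conjugation symmetry. -/

lemma support_subset_measure_support {ρ : ℝ → ℝ} (hρ : Continuous ρ) (h0 : ∀ x, 0 ≤ ρ x) :
    Function.support ρ ⊆ (volume.withDensity fun x => ENNReal.ofReal (ρ x)).support := by
  intro x hx
  rw [Measure.mem_support_iff_forall]
  intro U hU
  rw [pos_iff_ne_zero, Ne, withDensity_apply_eq_zero' (by fun_prop)]
  refine (Measure.measure_pos_of_mem_nhds volume (inter_mem ?_ hU)).ne'
  filter_upwards [hρ.continuousAt.eventually_ne hx] with y hy
  simpa using lt_of_le_of_ne (h0 y) (Ne.symm hy)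

lemma stieltjes_withDensity {ρ : ℝ → ℝ} (hρ : Continuous ρ) (h0 : ∀ x, 0 ≤ ρ x) (z : ℂ) :
    stieltjes (volume.withDensity fun x => ENNReal.ofReal (ρ x)) z = cauchyIntegral ρ z := by
  have hae : ∀ᵐ x ∂(volume.withDensity fun x => ENNReal.ofReal (ρ x)),
      x ∈ (volume.withDensity fun x => ENNReal.ofReal (ρ x)).support := Measure.support_mem_ae
  rw [stieltjes, Measure.restrict_eq_self_of_ae_mem hae,
    integral_withDensity_eq_integral_toReal_smul (by fun_prop)
      (Eventually.of_forall fun _ => ENNReal.ofReal_lt_top), cauchyIntegral]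
  refine integral_congr_ae (Eventually.of_forall fun t => ?_)
  simp [ENNReal.toReal_ofReal (h0 t)]

lemma cauchyIntegral_conj (ρ : ℝ → ℝ) (z : ℂ) :
    cauchyIntegral ρ (conj z) = conj (cauchyIntegral ρ z) := by
  rw [cauchyIntegral, cauchyIntegral, ← integral_conj]
  simp

lemma cauchyIntegral_im_nonneg {ρ : ℝ → ℝ} (h0 : ∀ x, 0 ≤ ρ x) {z : ℂ} (hz : z.im ≤ 0) :
    0 ≤ (cauchyIntegral ρ z).im := by
  by_cases hint : Integrable fun t : ℝ => (ρ t : ℂ) * (1 / (z - t))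
  · have := integral_im hint
    simp only [RCLike.im_eq_complex_im, ofReal_mul_one_div_im] at this
    rw [cauchyIntegral, ← this]
    exact integral_nonneg fun t => mul_nonneg (h0 t)
      (div_nonneg (by linarith) (by positivity))
  -- A divergent integral has the default value 0.
  · rw [cauchyIntegral, integral_undef hint, zero_im]

lemma analyticOrderAt_le_conj_conj (f : ℂ → ℂ) (z : ℂ) :
    analyticOrderAt f z ≤ analyticOrderAt (conj ∘ f ∘ conj) (conj z) := by
  have han : ∀ {g : ℂ → ℂ}, AnalyticAt ℂ g z → AnalyticAt ℂ (conj ∘ g ∘ conj) (conj z) := by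
    intro g hg
    rw [analyticAt_iff_eventually_differentiableAt] at hg ⊢
    have hc : Tendsto (conj : ℂ → ℂ) (𝓝 (conj z)) (𝓝 z) := by
      simpa using (continuous_conj.tendsto (conj z))
    filter_upwards [hc.eventually hg] with w hw
    simpa using hw.conj_conj
  by_cases hf : AnalyticAt ℂ f z
  · refine ENat.forall_natCast_le_iff_le.1 fun n hn => ?_
    obtain ⟨g, hg, hfg⟩ := (natCast_le_analyticOrderAt hf).1 hn
    refine (natCast_le_analyticOrderAt (han hf)).2 ⟨_, han hg, ?_⟩
    have hc : Tendsto (conj : ℂ → ℂ) (𝓝 (conj z)) (𝓝 z) := by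
      simpa using (continuous_conj.tendsto (conj z))
    filter_upwards [hc.eventually hfg] with w hw
    simp [hw]
  -- The order is 0 by convention where f is not analytic.
  · simp [analyticOrderAt_of_not_analyticAt hf]

lemma numSolutions_le_conj {ρ : ℝ → ℝ} (hρ : Continuous ρ) (h0 : ∀ x, 0 ≤ ρ x) (ζ : ℂ) :
    numSolutions (volume.withDensity fun x => ENNReal.ofReal (ρ x)) ζ ≤
      numSolutions (volume.withDensity fun x => ENNReal.ofReal (ρ x)) (conj ζ) := by
  set μ := volume.withDensity fun x => ENNReal.ofReal (ρ x)
  have hst : ∀ z, stieltjes μ (conj z) = conj (stieltjes μ z) := fun z => by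
    simp only [μ, stieltjes_withDensity hρ h0, cauchyIntegral_conj]
  refine iSup₂_le fun s hs => ?_
  have hinj : Function.Injective (conj : ℂ → ℂ) := (starRingEnd ℂ).injective
  refine le_trans ?_ (le_iSup₂_of_le (s.map ⟨conj, hinj⟩) ?_ le_rfl)
  · rw [Finset.sum_map]
    refine Finset.sum_le_sum fun z _ => (analyticOrderAt_le_conj_conj _ z).trans_eq ?_
    congr 1
    ext w
    simp [hst]
  · intro z hz
    obtain ⟨w, hw, rfl⟩ := Finset.mem_map.1 hz
    obtain ⟨h1, h2⟩ := hs w hw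
    refine ⟨?_, by simp [hst, h2]⟩
    rintro ⟨x, hx, hxw⟩
    refine h1 ⟨x, hx, ?_⟩
    apply hinj
    simpa using hxw

/-- The bound on the number of solutions for `ζ` in the lower half-plane. -/
lemma two_mul_numSolutions_le {ρ : ℝ → ℝ} (hρ : Continuous ρ) (h0 : ∀ x, 0 ≤ ρ x)
    (hs : HasCompactSupport ρ) {C α : ℝ≥0} (hα : 0 < α) (hh : HolderWith C α ρ) {ζ : ℂ}
    (hζ : ζ.im < 0) (hne : ∀ x : ℝ, cauchyExtension ρ x ≠ ζ) :
    2 * numSolutions (volume.withDensity fun x => ENNReal.ofReal (ρ x)) ζ ≤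
      numComponents {x : ℝ | ρ x = |ζ.im| / Real.pi} := by
  have hF := halfPlaneFunction_cauchyExtension hρ hs hα hh hne
  obtain ⟨n, hn, hsum⟩ := hF.exists_bound (by simpa using hζ)
  have hset : {x : ℝ | (cauchyExtension ρ x - ζ).im = 0} = {x : ℝ | ρ x = |ζ.im| / Real.pi} := by
    ext x
    rw [Set.mem_ofPred_eq, Set.mem_ofPred_eq, sub_im, cauchyExtension_ofReal_im, abs_of_neg hζ,
      eq_div_iff Real.pi_ne_zero]
    constructor <;> intro h <;> linarith
  rw [← hset]
  refine le_trans ?_ hn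
  gcongr
  refine iSup₂_le fun s hsol => ?_
  -- Elsewhere, also at real points off Γ, the imaginary part is nonnegative, whereas Im ζ < 0.
  have hpos : ∀ z ∈ s, 0 < z.im := fun z hz => by
    by_contra! hle
    have h1 := (hsol z hz).2
    rw [stieltjes_withDensity hρ h0] at h1
    have := cauchyIntegral_im_nonneg h0 hle
    rw [h1] at this
    linarith
  refine le_trans (Finset.sum_congr rfl fun z hz => analyticOrderAt_congr ?_).le (hsum s ?_)
  · filter_upwards [isOpen_halfPlane.mem_nhds (hpos z hz)] with w hw
    rw [stieltjes_withDensity hρ h0, cauchyExtension_eq hρ hs hw]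
  · intro z hz
    refine ⟨hpos z hz, ?_⟩
    rw [cauchyExtension_eq hρ hs (hpos z hz), ← stieltjes_withDensity hρ h0, (hsol z hz).2,
      sub_self]

/-! ### The boundary curve. -/

/-- For 0 < r < 1 and a < b the sign is opposite to that of sin t: the lower half disc goes to the
upper half-plane. -/
lemma affineMap_joukowski_im (a b r t : ℝ) :
    (affineMap a b (joukowski (r * exp (t * I)))).im =
      (b - a) / 2 * ((r - r⁻¹) / 2 * Real.sin t) := by
  have h1 : (r : ℂ) * exp (t * I) + 1 / (r * exp (t * I)) =
      r * exp ((t : ℝ) * I) + (r⁻¹ : ℝ) * exp ((-t : ℝ) * I) := by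
    push_cast
    rw [neg_mul, exp_neg, one_div, mul_inv]
  have h2 : (joukowski (r * exp (t * I))).im = (r - r⁻¹) / 2 * Real.sin t := by
    rw [joukowski, h1, show (1 / 2 : ℂ) = ((1 / 2 : ℝ) : ℂ) by push_cast; rfl, im_ofReal_mul,
      add_im, im_ofReal_mul, im_ofReal_mul, exp_ofReal_mul_I_im, exp_ofReal_mul_I_im,
      Real.sin_neg]
    ring
  have h3 : ∀ z : ℂ, affineMap a b z = ((b + a) / 2 : ℝ) + ((b - a) / 2 : ℝ) * z := fun z => by
    rw [affineMap]; push_cast; rfl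
  rw [h3, add_im, ofReal_im, zero_add, im_ofReal_mul, h2]

lemma tendsto_affineMap_joukowski (a b t : ℝ) :
    Tendsto (fun r : ℝ => affineMap a b (joukowski (r * exp (t * I)))) (𝓝[<] 1)
      (𝓝 (((b + a) / 2 + (b - a) / 2 * Real.cos t : ℝ) : ℂ)) := by
  have hc : ContinuousAt (fun r : ℝ => affineMap a b (joukowski (r * exp (t * I)))) 1 := by
    unfold affineMap joukowski
    have : (((1 : ℝ) : ℂ) * exp (t * I)) ≠ 0 := by simp
    fun_prop (disch := assumption)
  have hv : affineMap a b (joukowski (((1 : ℝ) : ℂ) * exp (t * I))) =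
      (((b + a) / 2 + (b - a) / 2 * Real.cos t : ℝ) : ℂ) := by
    rw [affineMap, joukowski, ofReal_one, one_mul, one_div, one_div, ← exp_neg]
    push_cast
    rw [Complex.cos, neg_mul]
    ring
  rw [← hv]
  exact hc.tendsto.mono_left nhdsWithin_le_nhds

lemma innerCurve_two_pi_sub {ρ : ℝ → ℝ} (hρ : Continuous ρ) (h0 : ∀ x, 0 ≤ ρ x) (r t : ℝ) :
    innerCurve (volume.withDensity fun x => ENNReal.ofReal (ρ x)) r (2 * Real.pi - t) =
      conj (innerCurve (volume.withDensity fun x => ENNReal.ofReal (ρ x)) r t) := by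
  have h1 : exp (((2 * Real.pi - t : ℝ) : ℂ) * I) = conj (exp (t * I)) := by
    rw [← exp_conj, map_mul, conj_ofReal, conj_I]
    push_cast
    rw [sub_mul, exp_sub, exp_two_pi_mul_I, mul_neg, exp_neg, one_div]
  rw [innerCurve, innerCurve, stieltjes_withDensity hρ h0, stieltjes_withDensity hρ h0,
    ← cauchyIntegral_conj, h1]
  simp [affineMap, joukowski, conj_ofNat]

/-- Points of positive density on the line are boundary points on the curve, from both sides. -/
lemma exists_boundaryCurve_eq {ρ : ℝ → ℝ} (hρ : Continuous ρ) (h0 : ∀ x, 0 ≤ ρ x)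
    (hs : HasCompactSupport ρ) {μ : Measure ℝ}
    (hμ : μ = volume.withDensity fun x => ENNReal.ofReal (ρ x)) (hμs : IsCompact μ.support)
    (hc : Continuous (cauchyExtension ρ)) {x : ℝ} (hx : ρ x ≠ 0) :
    cauchyExtension ρ x ∈ boundaryCurve μ '' Set.Icc 0 (2 * Real.pi) ∧
      conj (cauchyExtension ρ x) ∈ boundaryCurve μ '' Set.Icc 0 (2 * Real.pi) := by
  set a := sInf μ.support with ha
  set b := sSup μ.support with hb
  have hsub : Function.support ρ ⊆ μ.support := hμ ▸ support_subset_measure_support hρ h0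
  -- The support is a neighbourhood of x, so a < x < b strictly.
  have hev : ∀ᶠ y in 𝓝 x, y ∈ μ.support :=
    (hρ.continuousAt.eventually_ne hx).mono fun y hy => hsub hy
  obtain ⟨y, hy, hyx⟩ := ((hev.filter_mono nhdsWithin_le_nhds).and
    (self_mem_nhdsWithin : Set.Iio x ∈ 𝓝[<] x)).exists
  obtain ⟨y', hy', hyx'⟩ := ((hev.filter_mono nhdsWithin_le_nhds).and
    (self_mem_nhdsWithin : Set.Ioi x ∈ 𝓝[>] x)).exists
  have hax : a < x := (csInf_le hμs.bddBelow hy).trans_lt hyx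
  have hxb : x < b := lt_of_lt_of_le hyx' (le_csSup hμs.bddAbove hy')
  have hab : 0 < b - a := by linarith
  -- The preimage of x under the affine map.
  set c := (2 * x - (b + a)) / (b - a) with hcdef
  have hc1 : -1 < c := by rw [hcdef, lt_div_iff₀ hab]; linarith
  have hc2 : c < 1 := by rw [hcdef, div_lt_iff₀ hab]; linarith
  set τ := Real.arccos c with hτ
  have hτ0 : 0 < τ := Real.arccos_pos.2 hc2
  have hτpi : τ < Real.pi := Real.arccos_lt_pi.2 hc1
  have hcos : Real.cos (2 * Real.pi - τ) = c := by
    rw [Real.cos_two_pi_sub, Real.cos_arccos hc1.le hc2.le]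
  have hsin : Real.sin (2 * Real.pi - τ) < 0 := by
    rw [Real.sin_two_pi_sub, neg_lt_zero]
    exact Real.sin_pos_of_pos_of_lt_pi hτ0 hτpi
  -- The parameter 2π - τ has negative sine, so x is approached from the upper half-plane; τ gives
  -- the approach from below.
  have hlim : Tendsto (fun r => innerCurve μ r (2 * Real.pi - τ)) (𝓝[<] 1)
      (𝓝 (cauchyExtension ρ x)) := by
    have h1 := tendsto_affineMap_joukowski a b (2 * Real.pi - τ)
    rw [hcos, show (b + a) / 2 + (b - a) / 2 * c = x by rw [hcdef]; field_simp; ring] at h1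
    refine ((hc.tendsto _).comp h1).congr' ?_
    filter_upwards [Ioo_mem_nhdsLT (zero_lt_one' ℝ)] with r hr
    have him : 0 < (affineMap a b (joukowski (r * exp ((2 * Real.pi - τ : ℝ) * I)))).im := by
      rw [affineMap_joukowski_im]
      have : 1 < r⁻¹ := (one_lt_inv₀ hr.1).2 hr.2
      exact mul_pos (by linarith) (mul_pos_of_neg_of_neg (by linarith [hr.2]) hsin)
    rw [Function.comp_apply, cauchyExtension_eq hρ hs him, innerCurve, hμ,
      stieltjes_withDensity hρ h0, ← hμ]
  have hlim' : Tendsto (fun r => innerCurve μ r τ) (𝓝[<] 1)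
      (𝓝 (conj (cauchyExtension ρ x))) := by
    refine ((continuous_conj.tendsto _).comp hlim).congr fun r => ?_
    rw [Function.comp_apply, hμ, innerCurve_two_pi_sub hρ h0, conj_conj]
  exact ⟨⟨2 * Real.pi - τ, ⟨by linarith, by linarith⟩, hlim.limUnder_eq⟩,
    ⟨τ, ⟨hτ0.le, by linarith⟩, hlim'.limUnder_eq⟩⟩

end StieltjesInverse

theorem proposition3p4 (μ : Measure ℝ) (ρ : ℝ → ℝ) (hρ_nonneg : ∀ x, 0 ≤ ρ x)
    (hμ : μ = volume.withDensity (fun x => ENNReal.ofReal (ρ x)))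
    (hμ_supp : IsCompact μ.support)
    (hρ_holder : ∃ C α : ℝ≥0, 0 < α ∧ α ≤ 1 ∧ HolderWith C α ρ)
    (ζ : ℂ) (hζ_im : ζ.im ≠ 0)
    (hζ_curve : ζ ∉ StieltjesInverse.boundaryCurve μ '' Set.Icc 0 (2 * Real.pi)) :
    (StieltjesInverse.numSolutions μ ζ : ℝ≥0∞) ≤
      (1 / 2) * (StieltjesInverse.numComponents {x : ℝ | ρ x = |ζ.im| / Real.pi} : ℝ≥0∞) := by
  open StieltjesInverse in
  obtain ⟨C, α, hα, -, hh⟩ := hρ_holder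
  have hρ : Continuous ρ := hh.continuous hα
  have hs : HasCompactSupport ρ := HasCompactSupport.intro hμ_supp fun x hx => by
    by_contra h
    exact hx (hμ ▸ support_subset_measure_support hρ hρ_nonneg h)
  have hc := continuous_cauchyExtension hρ hs hα hh
  have hmem := fun x (hx : ρ x ≠ 0) =>
    exists_boundaryCurve_eq hρ hρ_nonneg hs hμ hμ_supp hc hx
  -- A nonreal boundary value forces ρ x ≠ 0, so avoiding γ_1 excludes real zeros.
  have hpos : ∀ (x : ℝ) (w : ℂ), w.im ≠ 0 → cauchyExtension ρ x = w → ρ x ≠ 0 := by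
    rintro x w hw rfl h
    exact hw (by rw [cauchyExtension_ofReal_im, h, mul_zero, neg_zero])
  have key : 2 * numSolutions μ ζ ≤ numComponents {x : ℝ | ρ x = |ζ.im| / Real.pi} := by
    rcases hζ_im.lt_or_gt with hneg | hpos'
    · rw [hμ]
      refine two_mul_numSolutions_le hρ hρ_nonneg hs hα hh hneg fun x hx => hζ_curve ?_
      exact hx ▸ (hmem x (hpos x ζ hζ_im hx)).1
    · have hconj : (starRingEnd ℂ ζ).im < 0 := by simpa using hpos'
      have h1 := two_mul_numSolutions_le hρ hρ_nonneg hs hα hh hconj fun x hx => hζ_curve (by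
        have := (hmem x (hpos x _ hconj.ne hx)).2
        rwa [hx, Complex.conj_conj] at this)
      rw [Complex.conj_im, abs_neg] at h1
      rw [hμ]
      exact (mul_le_mul_right (numSolutions_le_conj hρ hρ_nonneg ζ) 2).trans h1
  have key' : (2 : ℝ≥0∞) * (numSolutions μ ζ : ℝ≥0∞) ≤
      (numComponents {x : ℝ | ρ x = |ζ.im| / Real.pi} : ℝ≥0∞) := by
    have := ENat.toENNReal_le.2 key
    simpa using this
  calc (numSolutions μ ζ : ℝ≥0∞) = 1 / 2 * (2 * (numSolutions μ ζ : ℝ≥0∞)) := by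
        rw [← mul_assoc, one_div, ENNReal.inv_mul_cancel (by norm_num) (by norm_num), one_mul]
    _ ≤ _ := by gcongr
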